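/- Let $q\ge 2$, let $A\in\mathbb{R}^{n\times n}$, and let $B_{i\sigma}\in\mathbb{R}^{n\times 1}$ ($i=1,\dots,q$, $\sigma=1,\dots,p$) satisfy $\sum_{i=1}^{q}B_{i\sigma}=0$ for every $\sigma$. Consider the array of $q$ systems $$\dot x_i=Ax_i+\sum_{\sigma=1}^{p}B_{i\sigma}u_\sigma,\qquad i=1,\dots,q,$$ with states $x_i(t)\in\mathbb{R}^n$ and scalar (integrable) inputs $u_\sigma$. The array is called controllable if for all initial states $(x_1(0),\dots,x_q(0))$ there are a finite time $\tau>0$ and inputs $u_\sigma:[0,\tau]\to\mathbb{R}$ such that $x_i(\tau)=x_j(\tau)$ for all $i,j$; it is called positively controllable if the inputs can always be chosen with values in $\mathbb{R}_{\ge 0}$. For each real eigenvalue $\mu$ of $A^{*}=A^{T}$ let $V_\mu\in\mathbb{R}^{n\times d_\mu}$ be a matrix of full column rank with $\operatorname{range}V_\mu=\operatorname{null}(A^{*}-\mu I_n)$, and let $\operatorname{inc}(V_\mu^{*}B_{::})\in\mathbb{R}^{(qd_\mu)\times p}$ be the block matrix whose $(i,\sigma)$ block is $V_\mu^{*}B_{i\sigma}$.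 For $d\ge 1$ let $\mathcal{S}_d=\operatorname{range}[\mathbf{1}_q\otimes I_d]\subset\mathbb{R}^{qd}$, where $\mathbf{1}_q$ is the $q$-vector of all ones. A real matrix $G$ with $qd$ rows and $\operatorname{range}G\subset\mathcal{S}_d^{\perp}$ is called strongly connected (with respect to $d$) if $\operatorname{cone}G=\{G\alpha:\alpha\ge 0\}\supset\mathcal{S}_d^{\perp}$, where $\alpha\ge0$ is understood entrywise. Then the array is positively controllable if and only if both of the following hold: 1. the array is controllable; 2. for every real eigenvalue $\mu$ of $A^{*}$, the matrix $\operatorname{inc}(V_\mu^{*}B_{::})$ is strongly connected (with $d=d_\mu$). -/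

import Mathlib

open scoped Matrix

noncomputable section

namespace RelArray

/-! ### Arrays and their controllability

An array of `q` linear time-invariant systems with common state matrix `A` (real, `n` by `n`) and
input vectors `B i σ` in `ℝ ^ n`, driven by `p` scalar inputs `u σ`:
`ẋ i = A (x i) + ∑ σ, u σ • B i σ`. -/

/-- The actuation is relative: `∑ i, B i σ = 0` for each input `σ`. -/
def IsRelative {q p n : ℕ} (B : Fin q → Fin p → (Fin n → ℝ)) : Prop :=
  ∀ σ, ∑ i, B i σ = 0

/-- `x` is a solution of the array equations on `[0, τ]` under the input `u`, in the sense of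
Caratheodory: each `x i` is continuous on `[0, τ]` and satisfies the integrated equation there.
(For `u` integrable on `[0, τ]` this says that `x i` is absolutely continuous and satisfies the
differential equation almost everywhere.) -/
def IsTrajectory {q p n : ℕ} (A : Matrix (Fin n) (Fin n) ℝ) (B : Fin q → Fin p → (Fin n → ℝ))
    (τ : ℝ) (u : Fin p → ℝ → ℝ) (x : Fin q → ℝ → (Fin n → ℝ)) : Prop :=
  ∀ i, ContinuousOn (x i) (Set.Icc 0 τ) ∧
    ∀ t ∈ Set.Icc 0 τ, x i t = x i 0 + ∫ s in (0 : ℝ)..t, (A *ᵥ x i s + ∑ σ, u σ s • B i σ)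

/-- Input signals on `[0, τ]`: integrable functions. -/
def IsInput {p : ℕ} (τ : ℝ) (u : Fin p → ℝ → ℝ) : Prop :=
  ∀ σ, IntervalIntegrable (u σ) MeasureTheory.volume 0 τ

/-- The input `u` steers the initial states `x₀` to synchrony at time `τ`. -/
def Synchronizes {q p n : ℕ} (A : Matrix (Fin n) (Fin n) ℝ) (B : Fin q → Fin p → (Fin n → ℝ))
    (τ : ℝ) (u : Fin p → ℝ → ℝ) (x₀ : Fin q → (Fin n → ℝ)) : Prop :=
  ∃ x : Fin q → ℝ → (Fin n → ℝ), IsTrajectory A B τ u x ∧ (∀ i, x i 0 = x₀ i) ∧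
    ∀ i j, x i τ = x j τ

/-- Controllability of the array. -/
def IsControllable {q p n : ℕ} (A : Matrix (Fin n) (Fin n) ℝ)
    (B : Fin q → Fin p → (Fin n → ℝ)) : Prop :=
  ∀ x₀ : Fin q → (Fin n → ℝ), ∃ τ : ℝ, 0 < τ ∧ ∃ u : Fin p → ℝ → ℝ,
    IsInput τ u ∧ Synchronizes A B τ u x₀

/-- Positive controllability of the array: the inputs can be chosen nonnegative. -/
def IsPositivelyControllable {q p n : ℕ} (A : Matrix (Fin n) (Fin n) ℝ)
    (B : Fin q → Fin p → (Fin n → ℝ)) : Prop :=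
  ∀ x₀ : Fin q → (Fin n → ℝ), ∃ τ : ℝ, 0 < τ ∧ ∃ u : Fin p → ℝ → ℝ,
    IsInput τ u ∧ (∀ σ, ∀ t ∈ Set.Icc 0 τ, 0 ≤ u σ t) ∧ Synchronizes A B τ u x₀

/-! ### Incidence matrices and strong connectivity -/

/-- The incidence matrix of a collection of vectors: the `(i, σ)` block is the column `B i σ`. -/
def inc {q p d : ℕ} (B : Fin q → Fin p → (Fin d → ℝ)) : Matrix (Fin q × Fin d) (Fin p) ℝ :=
  Matrix.of fun r σ => B r.1 σ r.2

/-- The collection `M B`, obtained by multiplying each vector of the collection by `M`. -/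
def mulColl {q p n d : ℕ} (M : Matrix (Fin d) (Fin n) ℝ) (B : Fin q → Fin p → (Fin n → ℝ)) :
    Fin q → Fin p → (Fin d → ℝ) :=
  fun i σ => M *ᵥ B i σ

/-- The synchronization subspace: the range of the Kronecker product of the all-ones column
of length `q` and the `d` by `d` identity. -/
def syncSubspace (q d : ℕ) : Submodule ℝ (EuclideanSpace ℝ (Fin q × Fin d)) :=
  LinearMap.range (Matrix.toEuclideanLin (𝕜 := ℝ)
    (Matrix.kroneckerMap (· * ·) (Matrix.replicateCol (Fin 1) (fun _ : Fin q => (1 : ℝ)))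
      (1 : Matrix (Fin d) (Fin d) ℝ)))

/-- The convex cone of nonnegative combinations of the columns of `G`. -/
def cone {q d p : ℕ} (G : Matrix (Fin q × Fin d) (Fin p) ℝ) :
    Set (EuclideanSpace ℝ (Fin q × Fin d)) :=
  {ζ | ∃ α : Fin p → ℝ, (∀ σ, 0 ≤ α σ) ∧ ζ = WithLp.toLp 2 (G *ᵥ α)}

/-- Generalized incidence matrices: the range is orthogonal to the synchronization subspace. -/
def IsClassG {q d p : ℕ} (G : Matrix (Fin q × Fin d) (Fin p) ℝ) : Prop :=
  ∀ α : Fin p → ℝ, WithLp.toLp 2 (G *ᵥ α) ∈ (syncSubspace q d)ᗮ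

/-- A generalized incidence matrix is strongly connected if its cone contains the orthogonal
complement of the synchronization subspace. -/
def IsStronglyConnected {q d p : ℕ} (G : Matrix (Fin q × Fin d) (Fin p) ℝ) : Prop :=
  IsClassG G ∧ ((syncSubspace q d)ᗮ : Set (EuclideanSpace ℝ (Fin q × Fin d))) ⊆ cone G

/-- `V` has full column rank and its range is the null space of `M - μ I`. -/
def IsEigenbasis {n d : ℕ} (M : Matrix (Fin n) (Fin n) ℝ) (μ : ℝ)
    (V : Matrix (Fin n) (Fin d) ℝ) : Prop :=
  V.rank = d ∧
    LinearMap.range (Matrix.toLin' V) = LinearMap.ker (Matrix.toLin' (M - μ • 1))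

end RelArray

end

/-! Pair states with costates by `∑ i, w i ⬝ᵥ x i`, where a relative costate `w` has `∑ i, w i = 0`
and so annihilates synchronous states. If `w` solves the adjoint equation, the pairing changes only
through the inputs (`IsTrajectory.sum_dotProduct_eq`). By duality of cones, strong connectivity at
`μ` says that no nonzero relative `w` with all blocks in the `μ`-eigenspace of `Aᵀ` is nonnegative
on every input direction (`isStronglyConnected_inc_mulColl_iff`).

Necessity: for such a `w`, nonnegative inputs can never decrease the pairing with `exp (-μ t) w`, so
the initial state `w` itself cannot be synchronized unless `w = 0`.

Sufficiency: if positive controllability fails, the cone of states reachable by nonnegative inputs,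
enlarged by the synchronous states, is proper, so a nonzero functional is nonnegative on it. Hence
the closed cone `K` of relative costates nonnegative on all `exp (-t A) B σ`, `t ≥ 0`, is nonzero.
Controllability gives a functional strictly positive on `K` away from zero, and `exp (-t Aᵀ)` maps
`K` into itself for `t ≥ 0`. A Perron–Frobenius theorem for semigroups
(`exists_eigenvector_of_semigroup_mapsTo_cone`) then yields a real eigenvector in `K`, contradicting
strong connectivity at its eigenvalue. -/

section

open Set Filter Topology MeasureTheory

/-! ### Convex cones and Perron–Frobenius theory in finite dimension -/

section Cone

variable {E : Type*} [NormedAddCommGroup E] [NormedSpace ℝ E] [FiniteDimensional ℝ E]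

/-- A convex cone in a finite-dimensional space which is not the whole space lies in a closed
half-space (no closedness of the cone is needed). -/
theorem exists_ne_zero_forall_mem_cone_nonneg {C : Set E} (h0 : (0 : E) ∈ C)
    (hadd : ∀ x ∈ C, ∀ y ∈ C, x + y ∈ C) (hsmul : ∀ c : ℝ, 0 ≤ c → ∀ x ∈ C, c • x ∈ C)
    {z : E} (hz : z ∉ C) : ∃ f : E →L[ℝ] ℝ, f ≠ 0 ∧ ∀ x ∈ C, 0 ≤ f x := by
  have hconv : Convex ℝ C := fun x hx y hy a b ha hb _ =>
    hadd _ (hsmul a ha x hx) _ (hsmul b hb y hy)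
  -- With interior, separate `z` from the open set `interior C`; without interior, `C` spans a
  -- proper subspace, and a functional vanishing on it serves.
  by_cases hint : (interior C).Nonempty
  · obtain ⟨f, hf⟩ := geometric_hahn_banach_open_point hconv.interior isOpen_interior
      (fun h => hz (interior_subset h))
    have hle : ∀ x ∈ C, f x ≤ f z := by
      intro x hx
      have hx' : x ∈ closure (interior C) := by
        rw [hconv.closure_interior_eq_closure_of_nonempty_interior hint]
        exact subset_closure hx
      have : closure (interior C) ⊆ {y | f y ≤ f z} :=
        closure_minimal (fun y hy => (hf y hy).le) (isClosed_le f.continuous continuous_const)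
      exact this hx'
    refine ⟨-f, ?_, fun x hx => ?_⟩
    · rintro h
      obtain ⟨y, hy⟩ := hint
      have := hf y hy
      rw [neg_eq_zero.mp h] at this
      simp at this
    · simp only [neg_apply, Left.nonneg_neg_iff]
      by_contra! hpos
      have h1 := hle _ (hsmul ((|f z| + 1) / f x) (by positivity) x hx)
      rw [map_smul, smul_eq_mul, div_mul_cancel₀ _ hpos.ne'] at h1
      linarith [le_abs_self (f z)]
  · rw [hconv.interior_nonempty_iff_affineSpan_eq_top,
      AffineSubspace.affineSpan_eq_top_iff_vectorSpan_eq_top_of_nonempty ℝ E E ⟨0, h0⟩] at hint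
    have hlt : vectorSpan ℝ C < ⊤ := lt_top_iff_ne_top.mpr hint
    obtain ⟨f, hf0, hf⟩ := Submodule.exists_le_ker_of_lt_top _ hlt
    refine ⟨LinearMap.toContinuousLinearMap f, ?_, fun x hx => ?_⟩
    · simpa using hf0
    · have : x -ᵥ (0 : E) ∈ vectorSpan ℝ C := vsub_mem_vectorSpan ℝ hx h0
      rw [vsub_eq_sub, sub_zero] at this
      exact (LinearMap.mem_ker.mp (hf this)).ge

variable {K : Set E} {φ : E →L[ℝ] ℝ}

/-- Finitely many functionals out of a family which is nonnegative on a cone and total there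
sum to a strictly positive functional. -/
theorem exists_strictly_positive_functional {S : Set (E →L[ℝ] ℝ)}
    (hS : ∀ f ∈ S, ∀ w ∈ K, 0 ≤ f w) (hK : ∀ w ∈ K, (∀ f ∈ S, f w = 0) → w = 0) :
    ∃ φ : E →L[ℝ] ℝ, ∀ w ∈ K, w ≠ 0 → 0 < φ w := by
  -- A basis of the span drawn from `S` is finite. If the sum over it vanishes at `w`, each
  -- nonnegative term does, hence all of `S` vanishes at `w`.
  obtain ⟨b, hbS, hspan, hli⟩ := exists_linearIndependent ℝ S
  have : Fintype b := hli.setFinite.fintype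
  refine ⟨∑ f : b, (f : E →L[ℝ] ℝ), fun w hw hw0 => ?_⟩
  have happ : (∑ f : b, (f : E →L[ℝ] ℝ)) w = ∑ f : b, (f : E →L[ℝ] ℝ) w := by simp
  have hnn : ∀ f : b, 0 ≤ (f : E →L[ℝ] ℝ) w := fun f => hS _ (hbS f.2) w hw
  rw [happ]
  refine lt_of_le_of_ne (Finset.sum_nonneg fun f _ => hnn f) fun h => hw0 (hK w hw fun f hf => ?_)
  have hz := (Finset.sum_eq_zero_iff_of_nonneg fun f _ => hnn f).mp h.symm
  have hle : Submodule.span ℝ b ≤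
      LinearMap.ker (ContinuousLinearMap.apply ℝ ℝ w).toLinearMap :=
    Submodule.span_le.mpr fun f hf => hz ⟨f, hf⟩ (Finset.mem_univ _)
  exact hle (hspan ▸ Submodule.subset_span hf)

/-- A closed cone with a strictly positive functional has a compact base. -/
theorem isCompact_cone_base (hcl : IsClosed K)
    (hsmul : ∀ c : ℝ, 0 ≤ c → ∀ x ∈ K, c • x ∈ K) (hφ : ∀ x ∈ K, x ≠ 0 → 0 < φ x) :
    IsCompact (K ∩ {x | φ x = 1}) := by
  have hcl' : IsClosed (K ∩ {x | φ x = 1}) :=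
    hcl.inter (isClosed_eq φ.continuous continuous_const)
  refine Metric.isCompact_of_isClosed_isBounded hcl' ?_
  have hS : IsCompact (K ∩ Metric.sphere (0 : E) 1) := (isCompact_sphere 0 1).inter_left hcl
  obtain hne | hne := (K ∩ Metric.sphere (0 : E) 1).eq_empty_or_nonempty
  · refine (Bornology.isBounded_singleton (x := (0 : E))).subset fun x hx => ?_
    by_contra hx0
    have hx0 : x ≠ 0 := hx0
    have : ‖x‖⁻¹ • x ∈ K ∩ Metric.sphere (0 : E) 1 :=
      ⟨hsmul _ (by positivity) x hx.1, by
        simp [norm_smul, norm_ne_zero_iff.mpr hx0]⟩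
    simp [hne] at this
  · obtain ⟨m, hm, hmin⟩ := hS.exists_isMinOn hne φ.continuous.continuousOn
    have hm0 : m ≠ 0 := by
      rintro rfl
      simpa using hm.2
    have hpos := hφ m hm.1 hm0
    refine (Metric.isBounded_closedBall (x := (0 : E)) (r := (φ m)⁻¹)).subset fun x hx => ?_
    have hx0 : x ≠ 0 := by
      rintro rfl
      simpa using hx.2
    have hxn : 0 < ‖x‖ := norm_pos_iff.mpr hx0
    have h1 : φ m ≤ φ (‖x‖⁻¹ • x) := hmin ⟨hsmul _ (by positivity) x hx.1, by
      simp [norm_smul, hxn.ne']⟩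
    rw [map_smul, show φ x = 1 from hx.2, smul_eq_mul, mul_one] at h1
    rw [mem_closedBall_zero_iff]
    exact (le_inv_comm₀ hpos hxn).mp h1

/-- Every convex cone in a finite-dimensional space has an order unit. -/
theorem exists_order_unit_of_cone (h0 : (0 : E) ∈ K) (hadd : ∀ x ∈ K, ∀ y ∈ K, x + y ∈ K)
    (hsmul : ∀ c : ℝ, 0 ≤ c → ∀ x ∈ K, c • x ∈ K) :
    ∃ u ∈ K, ∀ z ∈ K, ∃ δ : ℝ, 0 < δ ∧ u - δ • z ∈ K := by
  obtain ⟨b, hbK, hspan, hli⟩ := exists_linearIndependent ℝ K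
  have : Fintype b := (hli.setFinite).fintype
  have hsum : ∀ c : b → ℝ, (∀ i, 0 ≤ c i) → ∑ i, c i • (i : E) ∈ K := fun c hc =>
    Finset.sum_induction _ (· ∈ K) (fun x y hx hy => hadd x hx y hy) h0
      (fun i _ => hsmul _ (hc i) _ (hbK i.2))
  refine ⟨∑ i : b, (i : E), by simpa using hsum 1 (by simp), fun z hz => ?_⟩
  have hz' : z ∈ Submodule.span ℝ (Set.range ((↑) : b → E)) := by
    rw [Subtype.range_coe, hspan]
    exact Submodule.subset_span hz
  obtain ⟨c, rfl⟩ := (Submodule.mem_span_range_iff_exists_fun ℝ).mp hz'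
  have hS : 0 ≤ ∑ i, |c i| := Finset.sum_nonneg fun i _ => abs_nonneg _
  -- This `δ` keeps every coefficient `1 - δ * c i` nonnegative.
  refine ⟨(1 + ∑ i, |c i|)⁻¹, by positivity, ?_⟩
  rw [Finset.smul_sum, ← Finset.sum_sub_distrib]
  convert hsum (fun i => 1 - (1 + ∑ i, |c i|)⁻¹ * c i) (fun i => ?_) using 2 with i
  · rw [sub_smul, one_smul, smul_smul]
  · have h1 : c i ≤ 1 + ∑ i, |c i| := by
      have := Finset.single_le_sum (f := fun i => |c i|) (fun i _ => abs_nonneg _)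
        (Finset.mem_univ i)
      linarith [le_abs_self (c i)]
    rw [sub_nonneg, inv_mul_le_iff₀ (by positivity)]
    linarith

/-- Perron's theorem for strongly positive maps, by maximizing the Collatz–Wielandt function. -/
theorem exists_eigenvector_of_strongly_positive (hcl : IsClosed K)
    (hsmul : ∀ c : ℝ, 0 ≤ c → ∀ x ∈ K, c • x ∈ K) (hφ : ∀ x ∈ K, x ≠ 0 → 0 < φ x)
    (hne : ∃ x ∈ K, x ≠ 0) {T : E →L[ℝ] E} (hTK : ∀ x ∈ K, T x ∈ K)
    (hT : ∀ y ∈ K, y ≠ 0 → ∀ z ∈ K, ∃ δ : ℝ, 0 < δ ∧ T y - δ • z ∈ K) :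
    ∃ x ∈ K, φ x = 1 ∧ T x = φ (T x) • x := by
  have hφ0 : ∀ x ∈ K, 0 ≤ φ x := fun x hx => by
    obtain rfl | h := eq_or_ne x 0
    · simp
    · exact (hφ x hx h).le
  have hbase : ∀ x ∈ K, x ≠ 0 → (φ x)⁻¹ • x ∈ K ∩ {x | φ x = 1} := fun x hx h =>
    ⟨hsmul _ (inv_nonneg.mpr (hφ x hx h).le) x hx, by simp [(hφ x hx h).ne']⟩
  have hc := isCompact_cone_base hcl hsmul hφ
  obtain ⟨x₀, hx₀, hx₀'⟩ := hne
  -- The maximum `R` of `φ ∘ T` on the base bounds every `r` with `T x - r • x ∈ K`, so the pairs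
  -- `(x, r)` range over a compact set and `r` can be maximized.
  obtain ⟨m, -, hmax⟩ := hc.exists_isMaxOn ⟨_, hbase x₀ hx₀ hx₀'⟩
    (φ.comp T).continuous.continuousOn
  set R := φ (T m) with hR
  have hbound : ∀ x ∈ K ∩ {x | φ x = 1}, ∀ r : ℝ, T x - r • x ∈ K → r ≤ R := by
    intro x hx r hr
    have h1 := hφ0 _ hr
    rw [map_sub, map_smul, show φ x = 1 from hx.2, smul_eq_mul, mul_one] at h1
    have h2 : φ (T x) ≤ φ (T m) := hmax hx
    linarith
  have hP : IsCompact (((K ∩ {x | φ x = 1}) ×ˢ Icc 0 R) ∩ {a : E × ℝ | T a.1 - a.2 • a.1 ∈ K}) :=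
    (hc.prod isCompact_Icc).inter_right (hcl.preimage (by fun_prop))
  have hP0 : ((φ x₀)⁻¹ • x₀, (0 : ℝ)) ∈
      (((K ∩ {x | φ x = 1}) ×ˢ Icc 0 R) ∩ {a : E × ℝ | T a.1 - a.2 • a.1 ∈ K}) := by
    have h1 := hbase x₀ hx₀ hx₀'
    have h2 : T ((φ x₀)⁻¹ • x₀) - (0 : ℝ) • ((φ x₀)⁻¹ • x₀) ∈ K := by
      simpa using hTK _ h1.1
    exact ⟨⟨h1, le_rfl, hbound _ h1 _ h2⟩, h2⟩
  obtain ⟨⟨x, r⟩, ⟨⟨hx, hr0, -⟩, hxr⟩, hrmax⟩ := hP.exists_isMaxOn ⟨_, hP0⟩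
    continuous_snd.continuousOn
  simp only [mem_ofPred_eq] at hxr
  have hx0 : x ≠ 0 := by
    rintro rfl
    simpa using hx.2
  have hTx : 0 < φ (T x) := by
    obtain ⟨δ, hδ, h⟩ := hT x hx.1 hx0 x hx.1
    have := hφ0 _ h
    rw [map_sub, map_smul, show φ x = 1 from hx.2, smul_eq_mul, mul_one] at this
    linarith
  have hTx0 : T x ≠ 0 := by
    intro h
    simp [h] at hTx
  have hzero : T x - r • x = 0 := by
    by_contra hy
    -- If `T x ≠ r • x`, strong positivity at `T x - r • x` shows that the normalized `T x` admits
    -- `r + δ`, against maximality of `r`.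
    obtain ⟨δ, hδ, h⟩ := hT _ hxr hy _ (hTK x hx.1)
    have hb := hbase _ (hTK x hx.1) hTx0
    have h1 : T ((φ (T x))⁻¹ • T x) - (r + δ) • ((φ (T x))⁻¹ • T x) ∈ K := by
      have := hsmul (φ (T x))⁻¹ (by positivity) _ h
      convert this using 1
      simp only [map_smul, map_sub]
      module
    have h2 : r + δ ≤ r := hrmax (a := ((φ (T x))⁻¹ • T x, r + δ))
      ⟨⟨hb, by simp only at hr0 ⊢; linarith, hbound _ hb _ h1⟩, h1⟩
    linarith
  refine ⟨x, hx.1, hx.2, ?_⟩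
  have h := sub_eq_zero.mp hzero
  rw [h, map_smul, show φ x = 1 from hx.2, smul_eq_mul, mul_one]

/-- Perron–Frobenius: a linear map preserving a closed pointed cone in a finite-dimensional
space has an eigenvector in the cone. -/
theorem exists_eigenvector_of_mapsTo_cone (hcl : IsClosed K)
    (hadd : ∀ x ∈ K, ∀ y ∈ K, x + y ∈ K)
    (hsmul : ∀ c : ℝ, 0 ≤ c → ∀ x ∈ K, c • x ∈ K) (hφ : ∀ x ∈ K, x ≠ 0 → 0 < φ x)
    (hne : ∃ x ∈ K, x ≠ 0) {T : E →L[ℝ] E} (hTK : ∀ x ∈ K, T x ∈ K) :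
    ∃ x ∈ K, φ x = 1 ∧ T x = φ (T x) • x := by
  have h0 : (0 : E) ∈ K := by
    obtain ⟨x, hx, -⟩ := hne
    simpa using hsmul 0 le_rfl x hx
  have hφ0 : ∀ x ∈ K, 0 ≤ φ x := fun x hx => by
    obtain rfl | h := eq_or_ne x 0
    · simp
    · exact (hφ x hx h).le
  -- Adding `ε φ(·) u` with an order unit `u` makes `T` strongly positive; compactness of the base
  -- lets `ε → 0`.
  obtain ⟨u, hu, hunit⟩ := exists_order_unit_of_cone h0 hadd hsmul
  have key : ∀ k : ℕ, ∃ x ∈ K ∩ {x | φ x = 1},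
      T x + (1 / ((k : ℝ) + 1)) • φ x • u = φ (T x + (1 / ((k : ℝ) + 1)) • φ x • u) • x := by
    intro k
    have hε : 0 < 1 / ((k : ℝ) + 1) := by positivity
    obtain ⟨x, hx, hx1, h⟩ := exists_eigenvector_of_strongly_positive hcl hsmul hφ hne
      (T := T + (1 / ((k : ℝ) + 1)) • φ.smulRight u)
      (fun x hx => by
        simpa using hadd _ (hTK x hx) _ (hsmul _ hε.le _ (hsmul _ (hφ0 x hx) u hu)))
      (fun y hy hy0 z hz => by
        obtain ⟨δ, hδ, hδz⟩ := hunit z hz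
        have hφy := hφ y hy hy0
        refine ⟨1 / ((k : ℝ) + 1) * φ y * δ, by positivity, ?_⟩
        convert hadd _ (hTK y hy) _ (hsmul (1 / ((k : ℝ) + 1) * φ y) (by positivity) _ hδz) using 1
        simp only [add_apply, smul_apply,
          ContinuousLinearMap.smulRight_apply]
        module)
    exact ⟨x, ⟨hx, hx1⟩, by simpa using h⟩
  choose x hx hxT using key
  obtain ⟨a, ha, ψ, hψ, hlim⟩ := (isCompact_cone_base hcl hsmul hφ).tendsto_subseq hx
  refine ⟨a, ha.1, ha.2, ?_⟩
  have hε : Tendsto (fun k => 1 / (((ψ k : ℕ) : ℝ) + 1)) atTop (𝓝 0) :=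
    tendsto_one_div_add_atTop_nhds_zero_nat.comp hψ.tendsto_atTop
  have h1 : Tendsto (fun k => T (x (ψ k)) + (1 / (((ψ k : ℕ) : ℝ) + 1)) • φ (x (ψ k)) • u) atTop
      (𝓝 (T a)) := by
    simpa using ((T.continuous.tendsto a).comp hlim).add
      (hε.smul (((φ.continuous.tendsto a).comp hlim).smul_const u))
  have h2 := (((φ.continuous.tendsto _).comp h1).smul hlim)
  refine tendsto_nhds_unique h1 (h2.congr fun k => ?_)
  exact (hxT (ψ k)).symm

/-- A linear semigroup preserving a closed pointed cone has a generator with an eigenvector in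
the cone. -/
theorem exists_eigenvector_of_semigroup_mapsTo_cone (hcl : IsClosed K)
    (hadd : ∀ x ∈ K, ∀ y ∈ K, x + y ∈ K)
    (hsmul : ∀ c : ℝ, 0 ≤ c → ∀ x ∈ K, c • x ∈ K) (hφ : ∀ x ∈ K, x ≠ 0 → 0 < φ x)
    (hne : ∃ x ∈ K, x ≠ 0) {T : ℝ → E →L[ℝ] E} {M : E → E} (hT0 : ∀ x, T 0 x = x)
    (hTadd : ∀ s t x, T (s + t) x = T s (T t x))
    (hderiv : ∀ x, HasDerivAt (fun t => T t x) (M x) 0)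
    (hTK : ∀ t, 0 ≤ t → ∀ x ∈ K, T t x ∈ K) :
    ∃ x ∈ K, x ≠ 0 ∧ ∃ μ : ℝ, M x = μ • x := by
  have hpow : ∀ j : ℕ, (0 : ℝ) < (1 / 2) ^ j := fun j => by positivity
  -- Normalized eigenvectors of `T (2⁻ʲ)` in `K`. They are nested, since `T (2⁻ʲ)` is the square of
  -- `T (2⁻ʲ⁻¹)`, so one vector serves all dyadic times.
  set Ω : ℕ → Set E := fun j => (K ∩ {x | φ x = 1}) ∩
    {x | T ((1 / 2) ^ j) x = φ (T ((1 / 2) ^ j) x) • x} with hΩ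
  have hΩc : ∀ j, IsCompact (Ω j) := fun j =>
    (isCompact_cone_base hcl hsmul hφ).inter_right (isClosed_eq (by fun_prop) (by fun_prop))
  have hΩne : ∀ j, (Ω j).Nonempty := fun j => by
    obtain ⟨x, hx, hx1, h⟩ := exists_eigenvector_of_mapsTo_cone hcl hadd hsmul hφ hne
      (hTK _ (hpow j).le)
    exact ⟨x, ⟨hx, hx1⟩, h⟩
  have hΩmono : ∀ j, Ω (j + 1) ⊆ Ω j := by
    rintro j x ⟨hx, h⟩
    refine ⟨hx, ?_⟩
    have h : T ((1 / 2) ^ (j + 1)) x = φ (T ((1 / 2) ^ (j + 1)) x) • x := h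
    have h2 : T ((1 / 2) ^ j) x = (φ (T ((1 / 2) ^ (j + 1)) x) ^ 2) • x := by
      rw [show ((1 : ℝ) / 2) ^ j = (1 / 2) ^ (j + 1) + (1 / 2) ^ (j + 1) by ring, hTadd]
      set c := φ (T ((1 / 2) ^ (j + 1)) x)
      rw [h, map_smul, h, smul_smul, sq]
    simp only [mem_ofPred_eq]
    rw [h2, map_smul, show φ x = 1 from hx.2, smul_eq_mul, mul_one]
  obtain ⟨x, hx⟩ := IsCompact.nonempty_iInter_of_sequence_nonempty_isCompact_isClosed Ω hΩmono
    hΩne (hΩc 0) (fun j => (hΩc j).isClosed)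
  rw [mem_iInter] at hx
  have hx1 : φ x = 1 := (hx 0).1.2
  refine ⟨x, (hx 0).1.1, ?_, φ (M x), ?_⟩
  · rintro rfl
    simp at hx1
  have hseq : Tendsto (fun j : ℕ => ((1 : ℝ) / 2) ^ j) atTop (𝓝[≠] 0) :=
    tendsto_nhdsWithin_iff.mpr ⟨tendsto_pow_atTop_nhds_zero_of_lt_one (by norm_num) (by norm_num),
      Eventually.of_forall fun j => (hpow j).ne'⟩
  have hlim := (hasDerivAt_iff_tendsto_slope.mp (hderiv x)).comp hseq
  -- Each difference quotient at `x` along these times equals `φ` of itself times `x`; this passes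
  -- to the limit `M x`.
  refine tendsto_nhds_unique hlim ((((φ.continuous.tendsto _).comp hlim).smul_const x).congr
    fun j => ?_)
  have h : T ((1 / 2) ^ j) x = φ (T ((1 / 2) ^ j) x) • x := (hx j).2
  simp only [Function.comp, slope_def_module, sub_zero, hT0, map_smul, map_sub, hx1, smul_eq_mul]
  conv_rhs => rw [h]
  module

end Cone

/-! ### Integration by parts and adjoint duality for Carathéodory solutions -/

section Primitive

/-- Integration by parts against a primitive of an integrable function. -/
theorem mul_eq_add_integral_of_primitive {a a' g X : ℝ → ℝ} {τ : ℝ} (hτ : 0 ≤ τ)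
    (ha : ∀ t, HasDerivAt a (a' t) t) (ha' : Continuous a')
    (hg : IntervalIntegrable g volume 0 τ)
    (hX : ∀ t ∈ Icc 0 τ, X t = X 0 + ∫ s in (0 : ℝ)..t, g s) :
    a τ * X τ = a 0 * X 0 + ∫ s in (0 : ℝ)..τ, (a' s * X s + a s * g s) := by
  have hmem : (0 : ℝ) ∈ uIcc 0 τ := left_mem_uIcc
  have hF := hg.absolutelyContinuousOnInterval_intervalIntegral hmem
  have hG := (ha'.intervalIntegrable 0 τ).absolutelyContinuousOnInterval_intervalIntegral hmem
  have hGa : ∀ t, ∫ s in (0 : ℝ)..t, a' s = a t - a 0 := fun t =>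
    intervalIntegral.integral_eq_sub_of_hasDerivAt (fun s _ => ha s) (ha'.intervalIntegrable _ _)
  simp only [hGa] at hG
  -- The product rule is used for `(a - a 0) * (X - X 0)`, both factors being primitives; the terms
  -- with `X 0` and `a 0` are integrated separately.
  have h := hG.integral_deriv_mul_eq_sub hF
  have hac : Continuous a := continuous_iff_continuousAt.mpr fun t => (ha t).continuousAt
  have hcongr : ∫ s in (0 : ℝ)..τ, (a' s * X s + a s * g s) =
      ∫ s in (0 : ℝ)..τ, ((deriv (fun t => a t - a 0) s * (∫ r in (0 : ℝ)..s, g r) +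
        (a s - a 0) * deriv (fun t => ∫ r in (0 : ℝ)..t, g r) s) +
        (a' s * X 0 + a 0 * g s)) := by
    apply intervalIntegral.integral_congr_ae
    filter_upwards [hg.ae_hasDerivAt_integral] with s hs hs'
    have hs'' : s ∈ uIcc 0 τ := uIoc_subset_uIcc hs'
    rw [(hs hs'' 0 hmem).deriv, ((ha s).sub_const (a 0)).deriv,
      hX s (by rwa [uIcc_of_le hτ] at hs'')]
    ring
  have hi1 : IntervalIntegrable (fun s => a' s * X 0) volume 0 τ :=
    (ha'.mul continuous_const).intervalIntegrable _ _
  have hi2 : IntervalIntegrable (fun s => a 0 * g s) volume 0 τ := hg.const_mul _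
  rw [hcongr, intervalIntegral.integral_add _ (hi1.add hi2), h,
    intervalIntegral.integral_add hi1 hi2, intervalIntegral.integral_mul_const, hGa,
    intervalIntegral.integral_const_mul, hX τ ⟨hτ, le_rfl⟩, intervalIntegral.integral_same]
  · ring
  · exact (hG.intervalIntegrable_deriv.mul_continuousOn hF.continuousOn).add
      (hF.intervalIntegrable_deriv.continuousOn_mul hG.continuousOn)

variable {n : ℕ}

/-- Duality between a linear control system and its adjoint equation. -/
theorem dotProduct_eq_add_integral_of_adjoint {A : Matrix (Fin n) (Fin n) ℝ} {τ : ℝ} (hτ : 0 ≤ τ)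
    {w : ℝ → Fin n → ℝ} (hw : ∀ t, HasDerivAt w (-(Aᵀ *ᵥ w t)) t) {f x : ℝ → Fin n → ℝ}
    (hf : IntervalIntegrable f volume 0 τ) (hxc : ContinuousOn x (Icc 0 τ))
    (hx : ∀ t ∈ Icc 0 τ, x t = x 0 + ∫ s in (0 : ℝ)..t, (A *ᵥ x s + f s)) :
    w τ ⬝ᵥ x τ = w 0 ⬝ᵥ x 0 + ∫ s in (0 : ℝ)..τ, w s ⬝ᵥ f s := by
  have hwc : Continuous w := continuous_iff_continuousAt.mpr fun t => (hw t).continuousAt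
  have hwk : ∀ k, Continuous fun t => w t k := fun k => (continuous_apply k).comp hwc
  have hAw : Continuous fun t => -(Aᵀ *ᵥ w t) := by fun_prop
  have hAx : ContinuousOn (fun t => A *ᵥ x t) (uIcc 0 τ) := by
    rw [uIcc_of_le hτ]
    exact (Continuous.matrix_mulVec continuous_const continuous_id).comp_continuousOn hxc
  have hint : IntervalIntegrable (fun s => A *ᵥ x s + f s) volume 0 τ :=
    hAx.intervalIntegrable.add hf
  have hintk : ∀ k, IntervalIntegrable (fun s => (A *ᵥ x s + f s) k) volume 0 τ := fun k =>
    ⟨(ContinuousLinearMap.proj (R := ℝ) (φ := fun _ : Fin n => ℝ) k).integrable_comp hint.1,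
      (ContinuousLinearMap.proj (R := ℝ) (φ := fun _ : Fin n => ℝ) k).integrable_comp hint.2⟩
  have hxk : ∀ k, ContinuousOn (fun t => x t k) (uIcc 0 τ) := fun k => by
    rw [uIcc_of_le hτ]
    exact (continuous_apply k).comp_continuousOn hxc
  have hk : ∀ k, w τ k * x τ k = w 0 k * x 0 k +
      ∫ s in (0 : ℝ)..τ, ((-(Aᵀ *ᵥ w s)) k * x s k + w s k * (A *ᵥ x s + f s) k) := by
    intro k
    refine mul_eq_add_integral_of_primitive (a := fun t => w t k) (X := fun t => x t k) hτ
      (fun t => hasDerivAt_pi.mp (hw t) k) ((continuous_apply k).comp hAw) (hintk k) ?_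
    intro t ht
    have h := congrFun (hx t ht) k
    have hsub : IntervalIntegrable (fun s => A *ᵥ x s + f s) volume 0 t :=
      hint.mono_set (by rw [uIcc_of_le hτ, uIcc_of_le ht.1]; exact Icc_subset_Icc le_rfl ht.2)
    have h2 := (ContinuousLinearMap.proj (R := ℝ) (φ := fun _ : Fin n => ℝ) k
      ).intervalIntegral_comp_comm hsub
    simp only [ContinuousLinearMap.proj_apply] at h2
    rw [h2]
    exact h
  simp only [dotProduct]
  rw [Finset.sum_congr rfl fun k _ => hk k, Finset.sum_add_distrib,
    ← intervalIntegral.integral_finsetSum]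
  · congr 1
    refine intervalIntegral.integral_congr fun s _ => ?_
    -- The drift terms cancel, leaving only the forcing.
    have h : (Aᵀ *ᵥ w s) ⬝ᵥ x s = w s ⬝ᵥ (A *ᵥ x s) := by
      rw [Matrix.mulVec_transpose, Matrix.dotProduct_mulVec]
    simp only [dotProduct] at h
    simp only [Pi.add_apply, Pi.neg_apply, mul_add, neg_mul, Finset.sum_add_distrib,
      Finset.sum_neg_distrib, h]
    ring
  · intro k _
    exact (((continuous_apply k).comp hAw).continuousOn.mul (hxk k)).intervalIntegrable.add
      ((hintk k).continuousOn_mul (hwk k).continuousOn)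

end Primitive

/-! ### The matrix exponential flow -/

section Flow

variable {n : ℕ}

/-- The matrix exponential `exp (t A)`. -/
noncomputable def matrixFlow (A : Matrix (Fin n) (Fin n) ℝ) (t : ℝ) : Matrix (Fin n) (Fin n) ℝ :=
  NormedSpace.exp (t • A)

theorem matrixFlow_zero (A : Matrix (Fin n) (Fin n) ℝ) : matrixFlow A 0 = 1 := by
  simp [matrixFlow]

theorem matrixFlow_add (A : Matrix (Fin n) (Fin n) ℝ) (s t : ℝ) :
    matrixFlow A (s + t) = matrixFlow A s * matrixFlow A t := by
  rw [matrixFlow, add_smul]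
  exact Matrix.exp_add_of_commute _ _ ((Commute.refl A).smul_left s |>.smul_right t)

theorem matrixFlow_transpose (A : Matrix (Fin n) (Fin n) ℝ) (t : ℝ) :
    matrixFlow Aᵀ t = (matrixFlow A t)ᵀ := by
  rw [matrixFlow, ← Matrix.transpose_smul, Matrix.exp_transpose]
  rfl

open scoped Matrix.Norms.Operator in
theorem hasDerivAt_matrixFlow_apply (A : Matrix (Fin n) (Fin n) ℝ) (t : ℝ) (i j : Fin n) :
    HasDerivAt (fun t => matrixFlow A t i j) ((A * matrixFlow A t) i j) t := by
  have h := hasDerivAt_exp_smul_const' (𝕂 := ℝ) A t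
  exact ((LinearMap.toContinuousLinearMap (Matrix.entryLinearMap ℝ ℝ i j)).hasFDerivAt.comp_hasDerivAt
    t h)

theorem hasDerivAt_matrixFlow_mulVec (A : Matrix (Fin n) (Fin n) ℝ) {y : ℝ → Fin n → ℝ}
    {y' : Fin n → ℝ} {t : ℝ} (hy : HasDerivAt y y' t) :
    HasDerivAt (fun t => matrixFlow A t *ᵥ y t)
      (A *ᵥ (matrixFlow A t *ᵥ y t) + matrixFlow A t *ᵥ y') t := by
  rw [hasDerivAt_pi]
  intro i
  have h := HasDerivAt.fun_sum (u := Finset.univ) fun j _ =>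
    (hasDerivAt_matrixFlow_apply A t i j).mul (hasDerivAt_pi.mp hy j)
  convert h using 1
  · rfl
  · rw [Finset.sum_add_distrib, Matrix.mulVec_mulVec]
    rfl

theorem continuous_matrixFlow (A : Matrix (Fin n) (Fin n) ℝ) : Continuous (matrixFlow A) :=
  continuous_matrix fun i j => continuous_iff_continuousAt.mpr fun t =>
    (hasDerivAt_matrixFlow_apply A t i j).continuousAt

theorem hasDerivAt_matrixFlow_neg_mulVec (A : Matrix (Fin n) (Fin n) ℝ) (v : Fin n → ℝ) (t : ℝ) :
    HasDerivAt (fun t => matrixFlow A (-t) *ᵥ v) (-(A *ᵥ (matrixFlow A (-t) *ᵥ v))) t := by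
  have h := (hasDerivAt_matrixFlow_mulVec A (hasDerivAt_const (-t) v)).scomp t (hasDerivAt_neg t)
  simpa [Function.comp_def] using h

theorem matrixFlow_mul_neg (A : Matrix (Fin n) (Fin n) ℝ) (t : ℝ) :
    matrixFlow A t * matrixFlow A (-t) = 1 := by
  rw [← matrixFlow_add, add_neg_cancel, matrixFlow_zero]

end Flow

/-! ### Trajectories: duality and variation of constants -/

namespace RelArray

variable {q p n : ℕ} {A : Matrix (Fin n) (Fin n) ℝ} {B : Fin q → Fin p → (Fin n → ℝ)}

theorem IsTrajectory.sum_dotProduct_eq {τ : ℝ} (hτ : 0 ≤ τ) {u : Fin p → ℝ → ℝ}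
    {x : Fin q → ℝ → (Fin n → ℝ)} (hx : IsTrajectory A B τ u x) (hu : IsInput τ u)
    {w : Fin q → ℝ → Fin n → ℝ} (hw : ∀ i t, HasDerivAt (w i) (-(Aᵀ *ᵥ w i t)) t) :
    ∑ i, w i τ ⬝ᵥ x i τ = ∑ i, w i 0 ⬝ᵥ x i 0 +
      ∫ s in (0 : ℝ)..τ, ∑ σ, u σ s * ∑ i, w i s ⬝ᵥ B i σ := by
  have hwc : ∀ i, Continuous (w i) := fun i =>
    continuous_iff_continuousAt.mpr fun t => (hw i t).continuousAt
  have hint : ∀ i, IntervalIntegrable (fun s => ∑ σ, u σ s • B i σ) volume 0 τ := fun i => by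
    have := IntervalIntegrable.sum Finset.univ (f := fun σ s => u σ s • B i σ)
      fun σ _ => ⟨Integrable.smul_const (hu σ).1 (B i σ), Integrable.smul_const (hu σ).2 (B i σ)⟩
    rwa [Finset.sum_fn] at this
  rw [Finset.sum_congr rfl fun i _ => dotProduct_eq_add_integral_of_adjoint hτ (hw i) (hint i)
    (hx i).1 (hx i).2, Finset.sum_add_distrib, ← intervalIntegral.integral_finsetSum]
  · congr 1
    refine intervalIntegral.integral_congr fun s _ => ?_
    simp only [dotProduct_sum, dotProduct_smul, smul_eq_mul, Finset.mul_sum]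
    exact Finset.sum_comm
  · intro i _
    simp only [dotProduct_sum, dotProduct_smul, smul_eq_mul]
    have := IntervalIntegrable.sum Finset.univ (f := fun σ s => u σ s * (w i s ⬝ᵥ B i σ))
      fun σ _ => (hu σ).mul_continuousOn (by fun_prop)
    rwa [Finset.sum_fn] at this

theorem exists_isTrajectory (A : Matrix (Fin n) (Fin n) ℝ) (B : Fin q → Fin p → (Fin n → ℝ))
    {u : Fin p → ℝ → ℝ} (hu : ∀ σ, Continuous (u σ)) (x₀ : Fin q → Fin n → ℝ) (τ : ℝ) :
    ∃ x, IsTrajectory A B τ u x ∧ (∀ i, x i 0 = x₀ i) ∧ ∀ i t, x i t =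
      matrixFlow A t *ᵥ (x₀ i + ∫ s in (0 : ℝ)..t, matrixFlow A (-s) *ᵥ ∑ σ, u σ s • B i σ) := by
  have hfl : Continuous fun s : ℝ => matrixFlow A (-s) :=
    (continuous_matrixFlow A).comp continuous_neg
  have hc : ∀ i, Continuous fun s => matrixFlow A (-s) *ᵥ ∑ σ, u σ s • B i σ := fun i =>
    hfl.matrix_mulVec (continuous_finsetSum _ fun σ _ => (hu σ).smul continuous_const)
  set x : Fin q → ℝ → Fin n → ℝ := fun i t =>
    matrixFlow A t *ᵥ (x₀ i + ∫ s in (0 : ℝ)..t, matrixFlow A (-s) *ᵥ ∑ σ, u σ s • B i σ) with hx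
  have hd : ∀ i t, HasDerivAt (x i) (A *ᵥ x i t + ∑ σ, u σ t • B i σ) t := by
    intro i t
    have h1 := ((hc i).integral_hasStrictDerivAt 0 t).hasDerivAt.const_add (x₀ i)
    have h2 := hasDerivAt_matrixFlow_mulVec A h1
    rwa [Matrix.mulVec_mulVec _ (matrixFlow A t) (matrixFlow A (-t)), matrixFlow_mul_neg,
      Matrix.one_mulVec] at h2
  have hxc : ∀ i, Continuous (x i) := fun i =>
    continuous_iff_continuousAt.mpr fun t => (hd i t).continuousAt
  refine ⟨x, fun i => ⟨(hxc i).continuousOn, fun t _ => ?_⟩, fun i => ?_, fun i t => rfl⟩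
  · rw [intervalIntegral.integral_eq_sub_of_hasDerivAt (fun s _ => hd i s)]
    · abel
    · exact (Continuous.add (continuous_const.matrix_mulVec (hxc i))
        (continuous_finsetSum _ fun σ _ => (hu σ).smul continuous_const)).intervalIntegrable _ _
  · simp [hx, matrixFlow_zero]

end RelArray

namespace RelArray

/-! ### The pairing of states and costates -/

section Pairing

variable {q d : ℕ}

/-- The functional `w ↦ ∑ i, w i ⬝ᵥ c i`. -/
noncomputable def pairing (c : Fin q → Fin d → ℝ) : (Fin q → Fin d → ℝ) →L[ℝ] ℝ :=
  LinearMap.toContinuousLinearMap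
    { toFun := fun w => ∑ i, w i ⬝ᵥ c i
      map_add' := fun x y => by simp [add_dotProduct, Finset.sum_add_distrib]
      map_smul' := fun a x => by simp [smul_dotProduct, Finset.mul_sum] }

theorem pairing_apply (c w : Fin q → Fin d → ℝ) : pairing c w = ∑ i, w i ⬝ᵥ c i := rfl

theorem pairing_comm (c w : Fin q → Fin d → ℝ) : pairing c w = pairing w c := by
  simp only [pairing_apply, dotProduct_comm]

theorem exists_eq_pairing (f : (Fin q → Fin d → ℝ) →L[ℝ] ℝ) : ∃ w, f = pairing w := by
  refine ⟨fun i k => f (Pi.single i (Pi.single k 1)), ?_⟩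
  refine ContinuousLinearMap.coe_inj.mp (LinearMap.pi_ext' fun i => LinearMap.pi_ext' fun k => ?_)
  ext
  simp [pairing_apply, Pi.single_apply, dotProduct, ite_apply]

/-- A functional nonnegative on a subspace vanishes there; testing with `s = -∑ i, w i` suffices. -/
theorem sum_eq_zero_of_pairing_const_nonneg {w : Fin q → Fin d → ℝ}
    (h : ∀ s : Fin d → ℝ, 0 ≤ pairing w (fun _ => s)) : ∑ i, w i = 0 := by
  have hs : ∀ s : Fin d → ℝ, pairing w (fun _ => s) = s ⬝ᵥ ∑ i, w i := fun s => by
    rw [pairing_apply, dotProduct_sum]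
  have := h (-∑ i, w i)
  rw [hs, neg_dotProduct, Left.nonneg_neg_iff] at this
  exact dotProduct_self_eq_zero.mp (le_antisymm this (Finset.sum_nonneg fun k _ => mul_self_nonneg _))

theorem pairing_self_eq_zero {w : Fin q → Fin d → ℝ} (h : pairing w w ≤ 0) : w = 0 := by
  have h0 : ∀ i, 0 ≤ w i ⬝ᵥ w i := fun i => Finset.sum_nonneg fun k _ => mul_self_nonneg _
  rw [pairing_apply] at h
  have h1 := (Finset.sum_eq_zero_iff_of_nonneg fun i _ => h0 i).mp
    (le_antisymm h (Finset.sum_nonneg fun i _ => h0 i))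
  exact funext fun i => dotProduct_self_eq_zero.mp (h1 i (Finset.mem_univ i))

end Pairing

/-! ### Strong connectivity in dual form -/

section StronglyConnected

variable {q p d : ℕ}

theorem mem_syncSubspace {z : EuclideanSpace ℝ (Fin q × Fin d)} :
    z ∈ syncSubspace q d ↔ ∃ s : Fin d → ℝ, ∀ i k, z (i, k) = s k := by
  have key : ∀ (v : EuclideanSpace ℝ (Fin 1 × Fin d)) i k, Matrix.toEuclideanLin (𝕜 := ℝ)
    (Matrix.kroneckerMap (· * ·) (Matrix.replicateCol (Fin 1) (fun _ : Fin q => (1 : ℝ)))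
      (1 : Matrix (Fin d) (Fin d) ℝ)) v (i, k) = v (0, k) := by
    intro v i k
    simp [Matrix.toLpLin_apply, Matrix.mulVec, dotProduct, Fintype.sum_prod_type,
      Matrix.one_apply]
  constructor
  · rintro ⟨v, rfl⟩
    exact ⟨fun k => v (0, k), fun i k => key v i k⟩
  · rintro ⟨s, hs⟩
    refine ⟨WithLp.toLp 2 fun r => s r.2, ?_⟩
    ext ⟨i, k⟩
    rw [key, hs]

theorem mem_orthogonal_syncSubspace {z : EuclideanSpace ℝ (Fin q × Fin d)} :
    z ∈ (syncSubspace q d)ᗮ ↔ ∑ i, (fun k => z (i, k)) = 0 := by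
  rw [Submodule.mem_orthogonal]
  have key : ∀ (s : Fin d → ℝ), inner ℝ (WithLp.toLp 2 fun r : Fin q × Fin d => s r.2) z =
      ∑ k, s k * (∑ i, fun k => z (i, k)) k := by
    intro s
    simp only [PiLp.inner_apply, Fintype.sum_prod_type, Finset.sum_apply, Finset.mul_sum]
    rw [Finset.sum_comm]
    simp [mul_comm]
  constructor
  · intro h
    have h1 := h (WithLp.toLp 2 fun r => (∑ i, fun k => z (i, k)) r.2)
      (mem_syncSubspace.mpr ⟨∑ i, (fun k => z (i, k)), fun i k => rfl⟩)
    rw [key] at h1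
    exact dotProduct_self_eq_zero.mp h1
  · rintro h u hu
    obtain ⟨s, hs⟩ := mem_syncSubspace.mp hu
    obtain rfl : u = WithLp.toLp 2 fun r => s r.2 := by
      ext ⟨i, k⟩
      exact hs i k
    rw [key, h]
    simp

/-- Strong connectivity in dual form. -/
theorem isStronglyConnected_inc_iff {M : Fin q → Fin p → (Fin d → ℝ)} (hM : IsRelative M) :
    IsStronglyConnected (inc M) ↔ ∀ ζ : Fin q → Fin d → ℝ, ∑ i, ζ i = 0 →
      (∀ σ, 0 ≤ ∑ i, ζ i ⬝ᵥ M i σ) → ζ = 0 := by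
  have hG : ∀ α : Fin p → ℝ, ∀ i, (fun k => (inc M *ᵥ α) (i, k)) = ∑ σ, α σ • M i σ := by
    intro α i
    ext k
    simp [inc, Matrix.mulVec, dotProduct, mul_comm]
  have hclass : IsClassG (inc M) := by
    intro α
    rw [mem_orthogonal_syncSubspace]
    simp only [hG]
    rw [Finset.sum_comm]
    refine Finset.sum_eq_zero fun σ _ => ?_
    rw [← Finset.smul_sum, hM σ, smul_zero]
  constructor
  · rintro ⟨-, h⟩ ζ hζ hpos
    have hmem : WithLp.toLp 2 (fun r : Fin q × Fin d => -ζ r.1 r.2) ∈ (syncSubspace q d)ᗮ := by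
      rw [mem_orthogonal_syncSubspace]
      have : ∀ i, (fun k => -ζ i k) = -ζ i := fun i => rfl
      simp only [this, Finset.sum_neg_distrib, hζ, neg_zero]
    obtain ⟨α, hα, h2⟩ := h hmem
    have h3 : ∀ i, -ζ i = ∑ σ, α σ • M i σ := fun i => by
      rw [← hG]
      ext k
      exact congrArg (fun z : EuclideanSpace ℝ (Fin q × Fin d) => z (i, k)) h2
    refine pairing_self_eq_zero ?_
    have h4 : -pairing ζ ζ = ∑ σ, α σ * ∑ i, ζ i ⬝ᵥ M i σ := by
      rw [pairing_apply, ← Finset.sum_neg_distrib]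
      simp only [← dotProduct_neg, h3, dotProduct_sum, dotProduct_smul, smul_eq_mul,
        Finset.mul_sum]
      exact Finset.sum_comm
    have h5 : 0 ≤ ∑ σ, α σ * ∑ i, ζ i ⬝ᵥ M i σ :=
      Finset.sum_nonneg fun σ _ => mul_nonneg (hα σ) (hpos σ)
    linarith
  · intro h
    refine ⟨hclass, ?_⟩
    -- Enlarging the cone by the synchronous vectors makes any functional nonnegative on it
    -- relative, so that `h` applies and forces `C` to be everything.
    set C : Set (Fin q → Fin d → ℝ) := {x | ∃ α : Fin p → ℝ, (∀ σ, 0 ≤ α σ) ∧ ∃ s : Fin d → ℝ,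
      x = fun i => (∑ σ, α σ • M i σ) + s} with hC
    have huniv : ∀ x, x ∈ C := by
      by_contra! ⟨z, hz⟩
      obtain ⟨f, hf0, hf⟩ := exists_ne_zero_forall_mem_cone_nonneg (C := C)
        ⟨0, fun _ => le_rfl, 0, by ext; simp⟩
        (by
          rintro _ ⟨α, hα, s, rfl⟩ _ ⟨β, hβ, t, rfl⟩
          refine ⟨α + β, fun σ => add_nonneg (hα σ) (hβ σ), s + t, ?_⟩
          ext1 i
          simp only [Pi.add_apply, add_smul, Finset.sum_add_distrib]
          abel)
        (by
          rintro c hc _ ⟨α, hα, s, rfl⟩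
          refine ⟨c • α, fun σ => mul_nonneg hc (hα σ), c • s, ?_⟩
          ext1 i
          simp only [Pi.smul_apply, smul_add, Finset.smul_sum, smul_smul, smul_eq_mul]) hz
      obtain ⟨w, rfl⟩ := exists_eq_pairing f
      refine hf0 ?_
      rw [h w (sum_eq_zero_of_pairing_const_nonneg fun s => hf _
        ⟨0, fun _ => le_rfl, s, by ext; simp⟩) fun σ => ?_]
      · ext x
        simp [pairing_apply]
      · have h1 := hf (fun i => M i σ) ⟨Pi.single σ 1, fun τ => by
          by_cases h : τ = σ
          · subst h; simp
          · simp [h], 0, by ext; simp [Pi.single_apply]⟩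
        rwa [pairing_comm, pairing_apply] at h1
    intro z hz
    obtain ⟨α, hα, s, hs⟩ := huniv fun i k => z (i, k)
    refine ⟨α, hα, ?_⟩
    -- The synchronous remainder is also orthogonal to the synchronous vectors, hence zero.
    have h1 : z - WithLp.toLp 2 (inc M *ᵥ α) = 0 := by
      refine (Submodule.inf_orthogonal_eq_bot (syncSubspace q d)).le
        ⟨mem_syncSubspace.mpr ⟨s, fun i k => ?_⟩, Submodule.sub_mem _ hz (hclass α)⟩
      have h2 := congrFun (congrFun hs i) k
      rw [← hG] at h2
      simp only [Pi.add_apply] at h2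
      simp [h2]
    exact sub_eq_zero.mp h1

variable {n : ℕ} {A : Matrix (Fin n) (Fin n) ℝ} {B : Fin q → Fin p → (Fin n → ℝ)}

theorem IsRelative.mulColl (hB : IsRelative B) (M : Matrix (Fin d) (Fin n) ℝ) :
    IsRelative (mulColl M B) := fun σ => by
  simp only [RelArray.mulColl]
  rw [← Matrix.mulVec_sum, hB σ, Matrix.mulVec_zero]

/-- Strong connectivity at an eigenvalue in terms of relative eigenvectors. -/
theorem isStronglyConnected_inc_mulColl_iff (hB : IsRelative B) {μ : ℝ}
    {V : Matrix (Fin n) (Fin d) ℝ} (hV : IsEigenbasis Aᵀ μ V) :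
    IsStronglyConnected (inc (mulColl Vᵀ B)) ↔ ∀ w : Fin q → Fin n → ℝ, ∑ i, w i = 0 →
      (∀ i, Aᵀ *ᵥ w i = μ • w i) → (∀ σ, 0 ≤ ∑ i, w i ⬝ᵥ B i σ) → w = 0 := by
  rw [isStronglyConnected_inc_iff (hB.mulColl Vᵀ)]
  have hinj : Function.Injective V.mulVec := by
    rw [Matrix.mulVec_injective_iff, linearIndependent_iff_card_eq_finrank_span, Set.finrank,
      ← Matrix.rank_eq_finrank_span_cols, hV.1, Fintype.card_fin]
  have hrange : ∀ v, (∃ ζ, V *ᵥ ζ = v) ↔ Aᵀ *ᵥ v = μ • v := by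
    intro v
    have h := SetLike.ext_iff.mp hV.2 v
    rw [LinearMap.mem_range, LinearMap.mem_ker] at h
    simp only [Matrix.toLin'_apply, Matrix.sub_mulVec, Matrix.smul_mulVec, Matrix.one_mulVec,
      sub_eq_zero] at h
    exact h
  have hpair : ∀ (ζ : Fin q → Fin d → ℝ) σ, ∑ i, (V *ᵥ ζ i) ⬝ᵥ B i σ =
      ∑ i, ζ i ⬝ᵥ mulColl Vᵀ B i σ := fun ζ σ => Finset.sum_congr rfl fun i _ => by
    rw [RelArray.mulColl, Matrix.dotProduct_mulVec, Matrix.vecMul_transpose]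
  constructor
  · intro h w hw hA hpos
    choose ζ hζ using fun i => (hrange (w i)).mpr (hA i)
    have h0 : ζ = 0 := by
      refine h ζ (hinj ?_) fun σ => ?_
      · rw [Matrix.mulVec_sum, Matrix.mulVec_zero, Finset.sum_congr rfl fun i _ => hζ i, hw]
      · rw [← hpair]
        simpa only [hζ] using hpos σ
    ext1 i
    rw [← hζ i, h0, Pi.zero_apply, Matrix.mulVec_zero, Pi.zero_apply]
  · intro h ζ hζ hpos
    have h0 := h (fun i => V *ᵥ ζ i) (by rw [← Matrix.mulVec_sum, hζ, Matrix.mulVec_zero])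
      (fun i => (hrange _).mp ⟨_, rfl⟩) fun σ => by rw [hpair]; exact hpos σ
    ext1 i
    exact hinj ((congrFun h0 i).trans (Matrix.mulVec_zero V).symm)

end StronglyConnected

/-! ### Necessity -/

section Necessity

variable {q p n : ℕ} {A : Matrix (Fin n) (Fin n) ℝ} {B : Fin q → Fin p → (Fin n → ℝ)}

theorem IsPositivelyControllable.isControllable (h : IsPositivelyControllable A B) :
    IsControllable A B := fun x₀ =>
  let ⟨τ, hτ, u, hu, _, hs⟩ := h x₀
  ⟨τ, hτ, u, hu, hs⟩

theorem IsPositivelyControllable.eq_zero_of_eigenvector (h : IsPositivelyControllable A B)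
    {μ : ℝ} {w : Fin q → Fin n → ℝ} (hw : ∑ i, w i = 0) (hA : ∀ i, Aᵀ *ᵥ w i = μ • w i)
    (hpos : ∀ σ, 0 ≤ ∑ i, w i ⬝ᵥ B i σ) : w = 0 := by
  -- Starting from `w` itself, duality with `exp (-μ t) w` reads `0 = pairing w w + (nonnegative
  -- integral)`.
  obtain ⟨τ, hτ, u, hu, hu0, x, hx, hx0, hxτ⟩ := h w
  have hd : ∀ i t, HasDerivAt (fun t => Real.exp (-μ * t) • w i)
      (-(Aᵀ *ᵥ (Real.exp (-μ * t) • w i))) t := by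
    intro i t
    have h1 := (((hasDerivAt_id t).const_mul (-μ)).exp).smul_const (w i)
    have h2 : -(Aᵀ *ᵥ (Real.exp (-μ * t) • w i)) = (Real.exp (-μ * id t) * (-μ * 1)) • w i := by
      rw [Matrix.mulVec_smul, hA]
      simp only [id]
      module
    rw [h2]
    exact h1
  have h1 := hx.sum_dotProduct_eq hτ.le hu hd
  have h2 : ∑ i, (Real.exp (-μ * τ) • w i) ⬝ᵥ x i τ = 0 := by
    rcases isEmpty_or_nonempty (Fin q) with _ | ⟨⟨j⟩⟩
    · simp
    · rw [Finset.sum_congr rfl fun i _ => by rw [hxτ i j], ← sum_dotProduct, ← Finset.smul_sum, hw,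
        smul_zero, zero_dotProduct]
  rw [h2] at h1
  simp only [hx0, mul_zero, Real.exp_zero, one_smul] at h1
  have h3 : 0 ≤ ∫ s in (0 : ℝ)..τ, ∑ σ, u σ s * ∑ i, (Real.exp (-μ * s) • w i) ⬝ᵥ B i σ := by
    refine intervalIntegral.integral_nonneg hτ.le fun s hs => Finset.sum_nonneg fun σ _ =>
      mul_nonneg (hu0 σ s hs) ?_
    simp only [smul_dotProduct, ← Finset.smul_sum]
    exact mul_nonneg (Real.exp_pos _).le (hpos σ)
  refine pairing_self_eq_zero ?_
  rw [pairing_apply]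
  linarith

end Necessity

/-! ### Sufficiency -/

section Sufficiency

variable {q p n : ℕ} {A : Matrix (Fin n) (Fin n) ℝ} {B : Fin q → Fin p → (Fin n → ℝ)}

/-- The initial states (up to sign) which continuous nonnegative inputs steer to synchrony. -/
def controllableCone (A : Matrix (Fin n) (Fin n) ℝ) (B : Fin q → Fin p → (Fin n → ℝ)) :
    Set (Fin q → Fin n → ℝ) :=
  {x | ∃ u : Fin p → ℝ → ℝ, (∀ σ, Continuous (u σ)) ∧ (∀ σ t, 0 ≤ u σ t) ∧ ∃ T : ℝ, 0 < T ∧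
    ∃ s : Fin n → ℝ, ∀ τ, T ≤ τ → ∀ i,
      x i = s + ∫ r in (0 : ℝ)..τ, matrixFlow A (-r) *ᵥ ∑ σ, u σ r • B i σ}

theorem continuous_matrixFlow_neg (A : Matrix (Fin n) (Fin n) ℝ) :
    Continuous fun t => matrixFlow A (-t) :=
  (continuous_matrixFlow A).comp continuous_neg

theorem continuous_matrixFlow_neg_mulVec_sum (A : Matrix (Fin n) (Fin n) ℝ)
    {u : Fin p → ℝ → ℝ} (hu : ∀ σ, Continuous (u σ)) (b : Fin p → Fin n → ℝ) :
    Continuous fun r => matrixFlow A (-r) *ᵥ ∑ σ, u σ r • b σ :=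
  (continuous_matrixFlow_neg A).matrix_mulVec
    (continuous_finsetSum _ fun σ _ => (hu σ).smul continuous_const)

theorem const_mem_controllableCone (s : Fin n → ℝ) : (fun _ => s) ∈ controllableCone A B :=
  ⟨0, fun _ => continuous_const, fun _ _ => le_rfl, 1, one_pos, s, fun τ _ i => by simp⟩

theorem add_mem_controllableCone {x y : Fin q → Fin n → ℝ} (hx : x ∈ controllableCone A B)
    (hy : y ∈ controllableCone A B) : x + y ∈ controllableCone A B := by
  obtain ⟨u, hu, hu0, T, hT, s, hx⟩ := hx
  obtain ⟨v, hv, hv0, T', -, s', hy⟩ := hy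
  -- The cone asks for its identity at all `τ ≥ T`, so two horizons merge at their maximum.
  refine ⟨u + v, fun σ => (hu σ).add (hv σ), fun σ t => add_nonneg (hu0 σ t) (hv0 σ t), max T T',
    lt_max_of_lt_left hT, s + s', fun τ hτ i => ?_⟩
  rw [Pi.add_apply, hx τ ((le_max_left _ _).trans hτ) i, hy τ ((le_max_right _ _).trans hτ) i]
  simp only [Pi.add_apply, add_smul, Finset.sum_add_distrib, Matrix.mulVec_add]
  rw [intervalIntegral.integral_add
    ((continuous_matrixFlow_neg_mulVec_sum A hu _).intervalIntegrable _ _)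
    ((continuous_matrixFlow_neg_mulVec_sum A hv _).intervalIntegrable _ _)]
  abel

theorem smul_mem_controllableCone {c : ℝ} (hc : 0 ≤ c) {x : Fin q → Fin n → ℝ}
    (hx : x ∈ controllableCone A B) : c • x ∈ controllableCone A B := by
  obtain ⟨u, hu, hu0, T, hT, s, hx⟩ := hx
  refine ⟨c • u, fun σ => (hu σ).const_smul c, fun σ t => mul_nonneg hc (hu0 σ t), T, hT, c • s,
    fun τ hτ i => ?_⟩
  rw [Pi.smul_apply, hx τ hτ i, smul_add, ← intervalIntegral.integral_smul]
  simp only [Pi.smul_apply, ← Finset.smul_sum, Matrix.mulVec_smul, smul_assoc]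

theorem isPositivelyControllable_of_controllableCone (h : ∀ x, x ∈ controllableCone A B) :
    IsPositivelyControllable A B := by
  intro x₀
  -- By variation of constants, an input whose integral is `-x₀ i - s` brings every system to `exp
  -- (T A) (-s)`.
  obtain ⟨u, hu, hu0, T, hT, s, hx⟩ := h (-x₀)
  obtain ⟨x, htraj, hx0, hform⟩ := exists_isTrajectory A B hu x₀ T
  refine ⟨T, hT, u, fun σ => (hu σ).intervalIntegrable _ _, fun σ t _ => hu0 σ t, x, htraj, hx0, ?_⟩
  have : ∀ i, x i T = matrixFlow A T *ᵥ (-s) := fun i => by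
    rw [hform]
    congr 1
    have h1 := hx T le_rfl i
    rw [Pi.neg_apply, neg_eq_iff_eq_neg] at h1
    rw [h1]
    abel
  exact fun i j => by rw [this, this]

theorem continuous_sum_dotProduct_matrixFlow (w : Fin q → Fin n → ℝ) (σ : Fin p) :
    Continuous fun t => ∑ i, w i ⬝ᵥ (matrixFlow A (-t) *ᵥ B i σ) :=
  continuous_finsetSum _ fun _ _ =>
    Continuous.dotProduct continuous_const
      ((continuous_matrixFlow_neg A).matrix_mulVec continuous_const)

/-- If the response `g` were negative at `t`, a continuous input concentrated where `g < 0` would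
produce a cone element on which `w` is negative. -/
theorem sum_dotProduct_matrixFlow_nonneg {w : Fin q → Fin n → ℝ}
    (hw : ∀ x ∈ controllableCone A B, 0 ≤ pairing w x) {t : ℝ} (ht : 0 ≤ t) (σ : Fin p) :
    0 ≤ ∑ i, w i ⬝ᵥ (matrixFlow A (-t) *ᵥ B i σ) := by
  set g : ℝ → ℝ := fun t => ∑ i, w i ⬝ᵥ (matrixFlow A (-t) *ᵥ B i σ) with hg
  have hgc : Continuous g := continuous_sum_dotProduct_matrixFlow w σ
  have hsum0 : ∑ i, w i = 0 :=
    sum_eq_zero_of_pairing_const_nonneg fun s => hw _ (const_mem_controllableCone s)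
  by_contra! hneg
  -- The first factor selects `g < 0`; the second switches the input off after `t + 1`, as
  -- membership in the cone requires, while being `1` at `t`.
  set v : ℝ → ℝ := fun r => max 0 (-g r) * max 0 (t + 1 - r) with hv
  have hvc : Continuous v := by fun_prop
  have hv0 : ∀ r, 0 ≤ v r := fun r => mul_nonneg (le_max_left _ _) (le_max_left _ _)
  have hint : ∀ i, Continuous fun r => v r • (matrixFlow A (-r) *ᵥ B i σ) := fun i =>
    hvc.smul ((continuous_matrixFlow_neg A).matrix_mulVec continuous_const)
  have hmem : (fun i => ∫ r in (0 : ℝ)..(t + 1), v r • (matrixFlow A (-r) *ᵥ B i σ)) ∈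
      controllableCone A B := by
    have hsingle : ∀ r i, ∑ σ', (Pi.single σ v : Fin p → ℝ → ℝ) σ' r • B i σ' = v r • B i σ := by
      intro r i
      rw [Finset.sum_eq_single σ (fun b _ hb => by simp [hb]) (by simp), Pi.single_eq_same]
    refine ⟨Pi.single σ v, fun σ' => ?_, fun σ' r => ?_, t + 1, by linarith, 0, fun τ hτ i => ?_⟩
    · by_cases h : σ' = σ
      · subst h; simpa using hvc
      · rw [Pi.single_eq_of_ne h]
        exact continuous_const
    · by_cases h : σ' = σ
      · subst h; simpa using hv0 r
      · simp [h]
    · simp only [hsingle, Matrix.mulVec_smul, zero_add]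
      rw [← intervalIntegral.integral_add_adjacent_intervals
        ((hint i).intervalIntegrable 0 (t + 1)) ((hint i).intervalIntegrable (t + 1) τ)]
      rw [left_eq_add]
      refine intervalIntegral.integral_zero_ae (Eventually.of_forall fun r hr => ?_)
      rw [uIoc_of_le hτ] at hr
      simp [hv, max_eq_left (show t + 1 - r ≤ 0 by linarith [hr.1])]
  have h1 := hw _ hmem
  have h2 : pairing w (fun i => ∫ r in (0 : ℝ)..(t + 1), v r • (matrixFlow A (-r) *ᵥ B i σ)) =
      ∫ r in (0 : ℝ)..(t + 1), v r * g r := by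
    rw [pairing_apply]
    have h3 : ∀ i, (∫ r in (0 : ℝ)..(t + 1), v r • (matrixFlow A (-r) *ᵥ B i σ)) ⬝ᵥ w i =
        ∫ r in (0 : ℝ)..(t + 1), v r * (w i ⬝ᵥ (matrixFlow A (-r) *ᵥ B i σ)) := by
      intro i
      have h4 := (LinearMap.toContinuousLinearMap (dotProductBilin ℝ ℝ (w i))).intervalIntegral_comp_comm
        ((hint i).intervalIntegrable (μ := volume) 0 (t + 1))
      simp at h4
      rw [dotProduct_comm, ← h4]
    rw [Finset.sum_congr rfl fun i _ => h3 i, ← intervalIntegral.integral_finsetSum]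
    · simp only [hg, Finset.mul_sum]
    · intro i _
      exact (hvc.mul (Continuous.dotProduct continuous_const
        ((continuous_matrixFlow_neg A).matrix_mulVec continuous_const))).intervalIntegrable _ _
  have h5 : 0 < ∫ r in (0 : ℝ)..(t + 1), -(v r * g r) := by
    refine intervalIntegral.integral_pos (by linarith) (hvc.mul hgc).neg.continuousOn
      (fun r _ => ?_) ⟨t, ⟨ht, by linarith⟩, ?_⟩
    · rcases le_total 0 (g r) with h | h
      · simp [hv, max_eq_left (neg_nonpos.mpr h)]
      · exact neg_nonneg.mpr (mul_nonpos_of_nonneg_of_nonpos (hv0 r) h)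
    · have : v t = -g t := by
        simpa [hv] using hneg.le
      rw [this]
      have hneg' : g t < 0 := hneg
      nlinarith
  rw [intervalIntegral.integral_neg, ← h2] at h5
  linarith

/-- Controllability makes the input directions total among relative costates. -/
theorem IsControllable.eq_zero_of_moments (h : IsControllable A B) {w : Fin q → Fin n → ℝ}
    (hw : ∑ i, w i = 0)
    (h0 : ∀ t, 0 ≤ t → ∀ σ, ∑ i, w i ⬝ᵥ (matrixFlow A (-t) *ᵥ B i σ) = 0) : w = 0 := by
  obtain ⟨τ, hτ, u, hu, x, hx, hx0, hxτ⟩ := h w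
  have h1 := hx.sum_dotProduct_eq hτ.le hu (w := fun i t => matrixFlow Aᵀ (-t) *ᵥ w i)
    fun i t => hasDerivAt_matrixFlow_neg_mulVec Aᵀ (w i) t
  have h2 : ∑ i, (matrixFlow Aᵀ (-τ) *ᵥ w i) ⬝ᵥ x i τ = 0 := by
    rcases isEmpty_or_nonempty (Fin q) with _ | ⟨⟨j⟩⟩
    · simp
    · rw [Finset.sum_congr rfl fun i _ => by rw [hxτ i j], ← sum_dotProduct, ← Matrix.mulVec_sum,
        hw, Matrix.mulVec_zero, zero_dotProduct]
  have h3 : ∫ s in (0 : ℝ)..τ, ∑ σ, u σ s * ∑ i, (matrixFlow Aᵀ (-s) *ᵥ w i) ⬝ᵥ B i σ = 0 := by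
    refine intervalIntegral.integral_zero_ae (Eventually.of_forall fun s hs => ?_)
    rw [uIoc_of_le hτ.le] at hs
    refine Finset.sum_eq_zero fun σ _ => ?_
    have := h0 s hs.1.le σ
    simp only [Matrix.dotProduct_mulVec] at this
    simp only [matrixFlow_transpose, Matrix.mulVec_transpose]
    rw [this, mul_zero]
  rw [h2, h3] at h1
  simp only [hx0, neg_zero, matrixFlow_zero, Matrix.one_mulVec, add_zero] at h1
  exact pairing_self_eq_zero h1.symm.le

/-- If a controllable array is not positively controllable, there is a real relative eigenvector
of `Aᵀ` which is nonnegative on all input directions. -/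
theorem IsControllable.exists_eigenvector (h : IsControllable A B)
    (hnot : ¬ IsPositivelyControllable A B) :
    ∃ (μ : ℝ) (w : Fin q → Fin n → ℝ), w ≠ 0 ∧ ∑ i, w i = 0 ∧ (∀ i, Aᵀ *ᵥ w i = μ • w i) ∧
      ∀ σ, 0 ≤ ∑ i, w i ⬝ᵥ B i σ := by
  obtain ⟨z, hz⟩ : ∃ z, z ∉ controllableCone A B := by
    by_contra! hall
    exact hnot (isPositivelyControllable_of_controllableCone hall)
  obtain ⟨f, hf0, hf⟩ := exists_ne_zero_forall_mem_cone_nonneg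
    (const_mem_controllableCone (0 : Fin n → ℝ)) (fun x hx y hy => add_mem_controllableCone hx hy)
    (fun c hc x hx => smul_mem_controllableCone hc hx) hz
  obtain ⟨w₀, rfl⟩ := exists_eq_pairing f
  set b : ℝ → Fin p → Fin q → Fin n → ℝ := fun t σ i => matrixFlow A (-t) *ᵥ B i σ with hb
  set K : Set (Fin q → Fin n → ℝ) :=
    {w | ∑ i, w i = 0 ∧ ∀ t, 0 ≤ t → ∀ σ, 0 ≤ pairing (b t σ) w} with hKdef
  have hKw₀ : w₀ ∈ K :=
    ⟨sum_eq_zero_of_pairing_const_nonneg fun s => hf _ (const_mem_controllableCone s),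
      fun t ht σ => sum_dotProduct_matrixFlow_nonneg hf ht σ⟩
  have hw₀ : w₀ ≠ 0 := by
    rintro rfl
    refine hf0 ?_
    ext x
    simp [pairing_apply]
  have hcl : IsClosed K := by
    have : K = {w | ∑ i, w i = 0} ∩ ⋂ (t : ℝ) (_ : 0 ≤ t) (σ : Fin p),
        {w | 0 ≤ pairing (b t σ) w} := by
      ext w
      simp [hKdef]
    rw [this]
    exact (isClosed_eq (by fun_prop) continuous_const).inter
      (isClosed_iInter fun t => isClosed_iInter fun _ => isClosed_iInter fun σ =>
        isClosed_le continuous_const (pairing (b t σ)).continuous)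
  obtain ⟨φ, hφ⟩ := exists_strictly_positive_functional (K := K)
    (S := {f | ∃ t : ℝ, 0 ≤ t ∧ ∃ σ, f = pairing (b t σ)})
    (by rintro _ ⟨t, ht, σ, rfl⟩ w hw; exact hw.2 t ht σ)
    (fun w hw h0 => h.eq_zero_of_moments hw.1 fun t ht σ => h0 _ ⟨t, ht, σ, rfl⟩)
  have hKadd : ∀ x ∈ K, ∀ y ∈ K, x + y ∈ K := fun x hx y hy =>
    ⟨by simp [Finset.sum_add_distrib, hx.1, hy.1], fun t ht σ => by
      rw [map_add]; exact add_nonneg (hx.2 t ht σ) (hy.2 t ht σ)⟩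
  have hKsmul : ∀ c : ℝ, 0 ≤ c → ∀ x ∈ K, c • x ∈ K := fun c hc x hx =>
    ⟨by simp [← Finset.smul_sum, hx.1], fun t ht σ => by
      rw [map_smul]; exact mul_nonneg hc (hx.2 t ht σ)⟩
  set T : ℝ → (Fin q → Fin n → ℝ) →L[ℝ] (Fin q → Fin n → ℝ) := fun t =>
    LinearMap.toContinuousLinearMap
      { toFun := fun w i => matrixFlow Aᵀ (-t) *ᵥ w i
        map_add' := fun x y => by ext1 i; simp [Matrix.mulVec_add]
        map_smul' := fun c x => by ext1 i; simp [Matrix.mulVec_smul] } with hT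
  have hTapp : ∀ t w i, T t w i = matrixFlow Aᵀ (-t) *ᵥ w i := fun _ _ _ => rfl
  obtain ⟨w, hwK, hw0, μ, hμ⟩ := exists_eigenvector_of_semigroup_mapsTo_cone hcl hKadd hKsmul hφ
    ⟨w₀, hKw₀, hw₀⟩ (T := T) (M := fun w i => -(Aᵀ *ᵥ w i))
    (fun x => by ext1 i; rw [hTapp, neg_zero, matrixFlow_zero, Matrix.one_mulVec])
    (fun s t x => by
      ext1 i
      rw [hTapp, hTapp, hTapp, Matrix.mulVec_mulVec, ← matrixFlow_add, neg_add])
    (fun x => by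
      rw [hasDerivAt_pi]
      intro i
      have h1 := hasDerivAt_matrixFlow_neg_mulVec Aᵀ (x i) 0
      rwa [neg_zero, matrixFlow_zero, Matrix.one_mulVec] at h1)
    (fun t ht w hw => by
      refine ⟨?_, fun s hs σ => ?_⟩
      · simp only [hTapp]
        rw [← Matrix.mulVec_sum, hw.1, Matrix.mulVec_zero]
      -- Moving `exp (-t Aᵀ)` across the pairing shifts the test time from `s` to `t + s`, which is
      -- still nonnegative.
      · have h1 := hw.2 (t + s) (add_nonneg ht hs) σ
        rw [pairing_apply] at h1 ⊢
        convert h1 using 2 with i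
        rw [hTapp, hb]
        simp only
        rw [neg_add, matrixFlow_add, ← Matrix.mulVec_mulVec, Matrix.dotProduct_mulVec (w i),
          matrixFlow_transpose, Matrix.mulVec_transpose])
  -- The semigroup has generator `-Aᵀ`, hence the sign; time `0` gives the condition on `B` itself.
  refine ⟨-μ, w, hw0, hwK.1, fun i => ?_, fun σ => ?_⟩
  · have h1 := congrFun hμ i
    rw [neg_smul, ← neg_eq_iff_eq_neg]
    exact h1
  · have h1 := hwK.2 0 le_rfl σ
    rw [pairing_apply] at h1
    simpa only [hb, neg_zero, matrixFlow_zero, Matrix.one_mulVec] using h1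

end Sufficiency

end RelArray

end

/-! ### The characterization of positive controllability -/

theorem theorem2 {q p n : ℕ} (hq : 2 ≤ q)
    (A : Matrix (Fin n) (Fin n) ℝ) (B : Fin q → Fin p → (Fin n → ℝ))
    (hB : RelArray.IsRelative B)
    (d : ℝ → ℕ) (V : (μ : ℝ) → Matrix (Fin n) (Fin (d μ)) ℝ)
    (hV : ∀ μ : ℝ, Module.End.HasEigenvalue (Matrix.toLin' Aᵀ) μ →
      RelArray.IsEigenbasis Aᵀ μ (V μ)) :
    RelArray.IsPositivelyControllable A B ↔
      RelArray.IsControllable A B ∧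
        ∀ μ : ℝ, Module.End.HasEigenvalue (Matrix.toLin' Aᵀ) μ →
          RelArray.IsStronglyConnected (RelArray.inc (RelArray.mulColl (V μ)ᵀ B)) := by
  constructor
  · refine fun h => ⟨h.isControllable, fun μ hμ => ?_⟩
    rw [RelArray.isStronglyConnected_inc_mulColl_iff hB (hV μ hμ)]
    exact fun w hw hA hpos => h.eq_zero_of_eigenvector hw hA hpos
  · rintro ⟨hc, hs⟩
    by_contra hnot
    obtain ⟨μ, w, hw0, hw, hA, hpos⟩ := hc.exists_eigenvector hnot
    -- One nonzero block certifies that `μ` is an eigenvalue of `Aᵀ`, so `hV` and `hs` apply to it.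
    obtain ⟨i, hi⟩ := Function.ne_iff.mp hw0
    have hμ : Module.End.HasEigenvalue (Matrix.toLin' Aᵀ) μ :=
      Module.End.hasEigenvalue_of_hasEigenvector
        (Module.End.hasEigenvector_iff.mpr ⟨Module.End.mem_eigenspace_iff.mpr (hA i), hi⟩)
    exact hw0 ((RelArray.isStronglyConnected_inc_mulColl_iff hB (hV μ hμ)).mp (hs μ hμ) w hw hA hpos)
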